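/- **Setting.** Let $V$ be a finite non-empty set with $n=|V|$, let $G=(V,E)$ be a simple graph with edge weights $w(e)\ge 0$, and let $\mathcal M$ be a matroid on $V$ of rank $k\ge 1$. For $S\subseteq V$ let $E_G(S)$ be the total weight of the edges having at least one endpoint in $S$. An independent set $S$ is a *$(1-\varepsilon)$-approximate solution* (of the matroid-constrained maximum vertex cover problem) if $E_G(S)\ge(1-\varepsilon)E_G(O)$ for every independent set $O$. The matroid $\mathcal M$ is *uniform* if its independent sets are the sets of at most $r$ elements, for some $r$; *laminar* if there are sets $V_1,\dots,V_r\subseteq V$, any two of which are disjoint or nested, and bounds $k_1,\dots,k_r\in\mathbb N$ such that $S$ is independent iff $|S\cap V_i|\le k_i$ for all $i$; *partition* if the same holds with $V_1,\dots,V_r$ a partition of $V$; *transversal* if there are sets $V_1,\dots,V_r\subseteq V$ such that $S$ is independent iff there is an injective map $\phi:S\to\{1,\dots,r\}$ with $u\in V_{\phi(u)}$ for all $u\in S$. **Model.** In the edge-arrival model the edges of $G$ arrive with their weights, each exactly once, in arbitrary order. A one-pass algorithm has a fixed number of variables, each of which is either a vertex variable (blank or holding a vertex) or a weight variable (holding a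 real number, initially $0$). When an edge arrives, the algorithm overwrites the variables, depending on the vertex variables, on the two endpoints, and on the comparisons ($\le$) among the weight variables and the arriving weight; the new value of a weight variable is $0$, the old value of some weight variable, the arriving weight, or the sum of the last two. After the stream the algorithm computes in the same memory, in finitely many steps, each of which depends on the vertex variables and on the comparisons among the weight variables and which either stops with an output set or overwrites the variables; here a weight variable may receive the sum of some weight variables minus the sum of some weight variables. The algorithm knows $V$, $k$, $\varepsilon$ and has free access to $\mathcal M$; it learns about $G$ and $w$ only through the stream. Time is not bounded. **Theorem.** There is an absolute constant $C>0$ such that for all $V$, $k\ge1$ and $0<\varepsilon\le1$ there is a one-pass edge-arrival streaming algorithm with at most $C\cdot\frac{nk}{\varepsilon}$ variables such that, for every uniform, partition, laminar or transversal matroid $\mathcal M$ of rank $k$ on $V$, every graph $G$ on $V$ with non-negative edge weights, and every order of arrival of its edges: 1. the algorithm stops, and its output is a $(1-\varepsilon)$-approximate solution; 2. after every initial segment of the stream, the memory holds (in variables whose position does not depend on $\mathcal M$, $G$, $w$ or the stream), for each vertex $v$, the weighted degree of $v$, that is, the sum of the weights of the edges incident to $v$ that have arrived, as well as $\lceil 2k/\varepsilon\rceil$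 edges of largest weight among the edges incident to $v$ that have arrived (all of these if they are fewer), each with its weight. -/

import Mathlib

open scoped BigOperators

noncomputable section

namespace MatroidVC

/-! ### Classes of matroids on a finite ground set -/

/-- Uniform matroid: the independent sets are the sets with at most `r` elements. -/
def IsUniform {V : Type*} (M : Matroid V) : Prop :=
  M.E = Set.univ ∧ ∃ r : ℕ, ∀ S : Set V, M.Indep S ↔ S.ncard ≤ r

/-- Partition matroid: the blocks `P 1, …, P r` partition the ground set, and `S` is independent
iff it has at most `c i` elements in the block `P i`, for every `i`. -/
def IsPartition {V : Type*} (M : Matroid V) : Prop :=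
  M.E = Set.univ ∧ ∃ (r : ℕ) (P : Fin r → Set V) (c : Fin r → ℕ),
    (∀ i j, i ≠ j → Disjoint (P i) (P j)) ∧ (⋃ i, P i) = Set.univ ∧
    ∀ S : Set V, M.Indep S ↔ ∀ i, (S ∩ P i).ncard ≤ c i

/-- Laminar matroid: any two members of the family are disjoint or nested, and `S` is
independent iff it has at most `c i` elements in `P i`, for every `i`. -/
def IsLaminar {V : Type*} (M : Matroid V) : Prop :=
  M.E = Set.univ ∧ ∃ (r : ℕ) (P : Fin r → Set V) (c : Fin r → ℕ),
    (∀ i j, Disjoint (P i) (P j) ∨ P i ⊆ P j ∨ P j ⊆ P i) ∧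
    ∀ S : Set V, M.Indep S ↔ ∀ i, (S ∩ P i).ncard ≤ c i

/-- Transversal matroid: `S` is independent iff its elements can be assigned to pairwise
distinct members of the family that contain them. -/
def IsTransversal {V : Type*} (M : Matroid V) : Prop :=
  M.E = Set.univ ∧ ∃ (r : ℕ) (P : Fin r → Set V),
    ∀ S : Set V, M.Indep S ↔ ∃ φ : S → Fin r, Function.Injective φ ∧ ∀ u : S, (u : V) ∈ P (φ u)

/-! ### Maximum vertex cover under a matroid constraint -/

open Classical in
/-- `E_G(S)`: the total weight of the edges with at least one endpoint in `S`. -/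
def coverWeight {V : Type*} [Fintype V] (G : SimpleGraph V) (w : Sym2 V → ℝ) (S : Finset V) : ℝ :=
  ∑ e ∈ Finset.univ.filter (fun e : Sym2 V => e ∈ G.edgeSet ∧ ∃ v ∈ S, v ∈ e), w e

/-- `S` is independent, and it covers at least `α` times the weight covered by any independent
set. -/
def IsApproxSolution {V : Type*} [Fintype V] (M : Matroid V) (G : SimpleGraph V) (w : Sym2 V → ℝ)
    (α : ℝ) (S : Finset V) : Prop :=
  M.Indep (S : Set V) ∧
    ∀ O : Finset V, M.Indep (O : Set V) → α * coverWeight G w O ≤ coverWeight G w S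

/-! ### One-pass edge-arrival streaming algorithms

The memory consists of `a` vertex variables, each blank or holding a vertex, and of `b` weight
variables, each holding a real number. To keep the count of variables meaningful, nothing but a
number obtained by adding up arriving weights can be put into a weight variable during the stream,
and the algorithm has access to the weights only through comparisons. -/

/-- Contents of the memory. -/
structure Memory (V : Type*) (a b : ℕ) where
  vtx : Fin a → Option V
  wt : Fin b → ℝ

/-- What a weight variable may be overwritten with when an edge arrives. -/
inductive Source (b : ℕ) where
  /-- the number zero -/
  | zero : Source b
  /-- the present value of variable `i` -/
  | copy (i : Fin b) : Source b
  /-- the weight of the arriving edge -/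
  | arriving : Source b
  /-- the present value of variable `i` plus the weight of the arriving edge -/
  | add (i : Fin b) : Source b

/-- Value of a source, for current values `y` and arriving weight `x`. -/
def Source.value {b : ℕ} (y : Fin b → ℝ) (x : ℝ) : Source b → ℝ
  | .zero => 0
  | .copy i => y i
  | .arriving => x
  | .add i => y i + x

/-- A one-pass algorithm with `a` vertex variables and `b` weight variables.
* When the edge `e` arrives, `update` gets the vertex variables, `e`, and the results of all
  comparisons (`≤`) between the weight variables (`some i`) and the arriving weight (`none`); it
  overwrites the memory.
* After the end of the stream, computation steps `post` are carried out in the same memory. Such a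
  step gets the vertex variables and the results of all comparisons between weight variables; it
  either stops with an output, or overwrites the memory, where a weight variable may be replaced by
  the sum of some weight variables minus the sum of some weight variables. -/
structure StreamAlg (V : Type*) (a b : ℕ) where
  init : Fin a → Option V
  update : (Fin a → Option V) → Sym2 V → (Option (Fin b) → Option (Fin b) → Prop) →
    (Fin a → Option V) × (Fin b → Source b)
  post : (Fin a → Option V) → (Fin b → Fin b → Prop) →
    Finset V ⊕ ((Fin a → Option V) × (Fin b → Finset (Fin b) × Finset (Fin b)))

namespace StreamAlg

variable {V : Type*} {a b : ℕ}

/-- The memory before the first edge arrives. -/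
def start (A : StreamAlg V a b) : Memory V a b := ⟨A.init, fun _ => 0⟩

/-- Processing of the arriving edge `e` of weight `x`. -/
def step (A : StreamAlg V a b) (m : Memory V a b) (e : Sym2 V) (x : ℝ) : Memory V a b :=
  let val : Option (Fin b) → ℝ := fun o => o.elim x m.wt
  let r := A.update m.vtx e (fun i j => val i ≤ val j)
  ⟨r.1, fun i => (r.2 i).value m.wt x⟩

/-- The memory after the edges of the list `p` have arrived, in this order. -/
def memAfter (A : StreamAlg V a b) (w : Sym2 V → ℝ) (p : List (Sym2 V)) : Memory V a b :=
  p.foldl (fun m e => A.step m e (w e)) A.start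

/-- One computation step after the stream: an output or a new memory. -/
def postStep (A : StreamAlg V a b) (m : Memory V a b) : Finset V ⊕ Memory V a b :=
  match A.post m.vtx (fun i j => m.wt i ≤ m.wt j) with
  | .inl S => .inl S
  | .inr r => .inr ⟨r.1, fun i => ∑ j ∈ (r.2 i).1, m.wt j - ∑ j ∈ (r.2 i).2, m.wt j⟩

/-- The output, if the algorithm stops within `N` computation steps from the memory `m`. -/
def runPost (A : StreamAlg V a b) : ℕ → Memory V a b → Option (Finset V)
  | 0, _ => none
  | N + 1, m =>
    match A.postStep m with
    | .inl S => some S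
    | .inr m' => runPost A N m'

/-- On the stream `l`, the algorithm stops and its output is `S`. -/
def Outputs (A : StreamAlg V a b) (w : Sym2 V → ℝ) (l : List (Sym2 V)) (S : Finset V) : Prop :=
  ∃ N : ℕ, A.runPost N (A.memAfter w l) = some S

end StreamAlg

/-- `l` is an edge-arrival stream of `G`: every edge appears exactly once, in arbitrary order. -/
def IsEdgeStream {V : Type*} (G : SimpleGraph V) (l : List (Sym2 V)) : Prop :=
  l.Nodup ∧ ∀ e, e ∈ l ↔ e ∈ G.edgeSet

/-! ### Storing weighted degrees and heaviest incident edges -/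

/-- The variables that serve to store the weighted degree of every vertex `v` and, for each of the
`L` slots of `v`, the other endpoint and the weight of an edge incident to `v`. -/
structure Layout (V : Type*) (a b L : ℕ) where
  deg : V → Fin b
  nbr : V → Fin L → Fin a
  wt : V → Fin L → Fin b

/-- `T` consists of the `L` heaviest elements of `F` (of all of them, if there are fewer); ties are
broken arbitrarily. -/
def IsHeaviest {α : Type*} (w : α → ℝ) (L : ℕ) (F T : Finset α) : Prop :=
  T ⊆ F ∧ T.card = min L F.card ∧ ∀ e ∈ T, ∀ f ∈ F, f ∉ T → w f ≤ w e

open Classical in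
/-- The members of the list `p` that are incident to `v`. -/
def incident {V : Type*} (p : List (Sym2 V)) (v : V) : Finset (Sym2 V) :=
  p.toFinset.filter (fun e => v ∈ e)

/-- The memory `m` holds the weighted degree of every vertex with respect to the edges in `p`, and
for every vertex `v` a set of `L` heaviest edges in `p` incident to `v`, each stored in exactly one
slot of `v`, together with its weight. -/
def Stores {V : Type*} {a b L : ℕ} (lay : Layout V a b L) (m : Memory V a b) (w : Sym2 V → ℝ)
    (p : List (Sym2 V)) : Prop :=
  (∀ v, m.wt (lay.deg v) = ∑ e ∈ incident p v, w e) ∧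
  ∀ v, ∃ T : Finset (Sym2 V), IsHeaviest w L (incident p v) T ∧
    (∀ u, s(v, u) ∈ T ↔ ∃ i, m.vtx (lay.nbr v i) = some u) ∧
    (∀ i j u, m.vtx (lay.nbr v i) = some u → m.vtx (lay.nbr v j) = some u → i = j) ∧
    (∀ i u, m.vtx (lay.nbr v i) = some u → m.wt (lay.wt v i) = w s(v, u))

end MatroidVC

end

noncomputable section

namespace MatroidVC

open scoped Classical

/-! ### Maintaining the heaviest edges at a vertex -/

section Slots

variable {V : Type*} {L : ℕ}

/-! The sum of the weighted degrees over `S` counts the edges inside `S` twice and the other covered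
edges once (`sum_degree_eq`). Subtracting the inner edges that are stored, once each, gives an
estimate that exceeds the covered weight by exactly the weight of the inner edges stored at neither
endpoint (`estimate_eq`).

This error is small (`sum_unstored_le`). An edge not stored at `v` has at most a fraction `1 / L ≤ ε
/ (2k)` of the degree of `v`, and at most `k` inner edges meet `v` when `|S| ≤ k`. So the error is
at most `ε / 2` times the degree sum, which in turn is at most twice the covered weight. Hence cover
≤ estimate ≤ (1 + ε) · cover. An independent set of largest estimate therefore covers at least `1 /
(1 + ε) ≥ 1 - ε` times the optimum.

Time being free, the search runs through all vertex sets. It needs only the current set, the best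
set and their two estimates, and each estimate is a signed sum of stored weights that is computed in
one step. -/

/-- The slots `N` (other endpoints) and `W` (weights) hold `L` heaviest elements of the set `F` of
edges incident to `v`. -/
def SlotsHold (w : Sym2 V → ℝ) (F : Finset (Sym2 V)) (v : V) (N : Fin L → Option V)
    (W : Fin L → ℝ) : Prop :=
  ∃ T : Finset (Sym2 V), IsHeaviest w L F T ∧
    (∀ u, s(v, u) ∈ T ↔ ∃ i, N i = some u) ∧
    (∀ i j u, N i = some u → N j = some u → i = j) ∧
    (∀ i u, N i = some u → W i = w s(v, u))

/-- Slot `j` can be overwritten by a new edge: it is blank, or no slot is blank and `j` holds a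
lightest edge, which is not heavier than the new one. -/
def Replaceable (N : Fin L → Option V) (le : Fin L → Fin L → Prop) (leNew : Fin L → Prop)
    (j : Fin L) : Prop :=
  N j = none ∨ ((∀ i, N i ≠ none) ∧ (∀ i, le j i) ∧ leNew j)

/-- The slot to be overwritten by a new edge, if any. -/
def victim (N : Fin L → Option V) (le : Fin L → Fin L → Prop) (leNew : Fin L → Prop) :
    Option (Fin L) :=
  if h : ∃ j, Replaceable N le leNew j then some h.choose else none

theorem replaceable_of_victim_eq_some {N : Fin L → Option V} {le : Fin L → Fin L → Prop}
    {leNew : Fin L → Prop} {j : Fin L} (h : victim N le leNew = some j) :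
    Replaceable N le leNew j := by
  unfold victim at h
  split_ifs at h with hex
  simp only [Option.some.injEq] at h
  exact h ▸ hex.choose_spec

theorem not_replaceable_of_victim_eq_none {N : Fin L → Option V} {le : Fin L → Fin L → Prop}
    {leNew : Fin L → Prop} (h : victim N le leNew = none) (j : Fin L) :
    ¬ Replaceable N le leNew j := by
  unfold victim at h
  split_ifs at h with hex
  exact fun hj => hex ⟨j, hj⟩

theorem slotsHold_empty (w : Sym2 V → ℝ) (v : V) (W : Fin L → ℝ) :
    SlotsHold w ∅ v (fun _ => none) W :=
  ⟨∅, ⟨by simp, by simp, by simp⟩, by simp, by simp, by simp⟩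

/-- The number of stored edges is the number of non-blank slots. -/
theorem card_eq_card_nonblank {v : V} {N : Fin L → Option V} {F T : Finset (Sym2 V)}
    (hF : ∀ e ∈ F, v ∈ e) (hTF : T ⊆ F)
    (hT : ∀ u, s(v, u) ∈ T ↔ ∃ i, N i = some u)
    (hinj : ∀ i j u, N i = some u → N j = some u → i = j) :
    T.card = (Finset.univ.filter fun i => N i ≠ none).card := by
  symm
  -- The default `v` is never used, since only non-blank slots are mapped.
  refine Finset.card_bij (fun i _ => s(v, (N i).getD v)) ?_ ?_ ?_
  · intro i hi
    obtain ⟨u, hu⟩ := Option.ne_none_iff_exists'.1 (Finset.mem_filter.1 hi).2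
    simpa [hu] using (hT u).2 ⟨i, hu⟩
  · intro i hi j hj hij
    obtain ⟨u, hu⟩ := Option.ne_none_iff_exists'.1 (Finset.mem_filter.1 hi).2
    obtain ⟨u', hu'⟩ := Option.ne_none_iff_exists'.1 (Finset.mem_filter.1 hj).2
    simp only [hu, hu', Option.getD_some, Sym2.congr_right] at hij
    exact hinj i j u hu (hij ▸ hu')
  · intro e he
    obtain ⟨u, rfl⟩ := Sym2.mem_iff_exists.1 (hF e (hTF he))
    obtain ⟨i, hi⟩ := (hT u).1 he
    exact ⟨i, by simp [hi], by simp [hi]⟩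

/-- Three cases: all slots are full with heavier edges, and the new edge is left out; some slot is
blank, so everything seen so far is stored and nothing is evicted; or all slots are full and a
lightest stored edge is exchanged for one at least as heavy. -/
theorem SlotsHold.insert_edge {w : Sym2 V → ℝ} {F : Finset (Sym2 V)} {v x : V}
    {N : Fin L → Option V} {W : Fin L → ℝ} (hL : 0 < L) (hF : ∀ e ∈ F, v ∈ e)
    (h : SlotsHold w F v N W) (hx : s(v, x) ∉ F) :
    SlotsHold w (insert s(v, x) F) v
      (fun i => if victim N (fun i j => W i ≤ W j) (fun i => W i ≤ w s(v, x)) = some i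
        then some x else N i)
      (fun i => if victim N (fun i j => W i ≤ W j) (fun i => W i ≤ w s(v, x)) = some i
        then w s(v, x) else W i) := by
  obtain ⟨T, ⟨hTF, hcard, hheavy⟩, hT, hinj, hW⟩ := h
  have hxT : s(v, x) ∉ T := fun h => hx (hTF h)
  have hNx : ∀ i, N i ≠ some x := fun i hi => hxT ((hT x).2 ⟨i, hi⟩)
  have hnb := card_eq_card_nonblank hF hTF hT hinj
  rcases hv : victim N (fun i j => W i ≤ W j) (fun i => W i ≤ w s(v, x)) with _ | j
  · have hno := not_replaceable_of_victim_eq_none hv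
    simp only [reduceCtorEq, if_false]
    have hfull : ∀ i, N i ≠ none := fun i hi => hno i (Or.inl hi)
    have hTL : T.card = L := by
      rw [hnb, Finset.filter_true_of_mem (fun i _ => hfull i)]; simp
    refine ⟨T, ⟨hTF.trans (Finset.subset_insert _ _), ?_, ?_⟩, hT, hinj, hW⟩
    · rw [Finset.card_insert_of_notMem hx]; omega
    · intro e he f hf hfT
      rcases Finset.mem_insert.1 hf with rfl | hf
      · have : Nonempty (Fin L) := ⟨⟨0, hL⟩⟩
        obtain ⟨i, hi⟩ := Finite.exists_min W
        -- The slot of least weight could be overwritten unless the new edge is strictly lighter,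
        -- hence lighter than every stored edge.
        have hlt : ¬ W i ≤ w s(v, x) := fun hle => hno i (Or.inr ⟨hfull, hi, hle⟩)
        obtain ⟨u, rfl⟩ := Sym2.mem_iff_exists.1 (hF e (hTF he))
        obtain ⟨i', hi'⟩ := (hT u).1 he
        rw [← hW i' u hi']
        exact (not_le.1 hlt).le.trans (hi i')
      · exact hheavy e he f hf hfT
  · simp only [Option.some.injEq]
    have hinj' : ∀ i i' u, (if j = i then some x else N i) = some u →
        (if j = i' then some x else N i') = some u → i = i' := by
      intro i i' u h1 h2
      split_ifs at h1 h2 with h3 h4 h4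
      · exact h3.symm.trans h4
      · exact absurd (h2.trans h1.symm) (hNx i')
      · exact absurd (h1.trans h2.symm) (hNx i)
      · exact hinj i i' u h1 h2
    have hW' : ∀ i u, (if j = i then some x else N i) = some u →
        (if j = i then w s(v, x) else W i) = w s(v, u) := by
      intro i u h1
      split_ifs at h1 ⊢ with h3
      · simp only [Option.some.injEq] at h1; rw [h1]
      · exact hW i u h1
    rcases replaceable_of_victim_eq_some hv with hblank | ⟨hfull, hmin, hle⟩
    · have hlt : T.card < L := by
        rw [hnb]
        calc _ < (Finset.univ : Finset (Fin L)).card :=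
              Finset.card_lt_card (Finset.filter_ssubset.2 ⟨j, Finset.mem_univ _, by simp [hblank]⟩)
          _ = L := by simp
      -- With fewer than `L` edges stored, the minimum in the cardinality condition is `F.card`.
      have hTF' : T = F := Finset.eq_of_subset_of_card_le hTF (by omega)
      subst hTF'
      refine ⟨insert s(v, x) T, ⟨subset_rfl, ?_, fun e _ f hf hf' => absurd hf hf'⟩, ?_, hinj',
        hW'⟩
      · rw [Finset.card_insert_of_notMem hx]; omega
      · intro u
        beta_reduce
        rw [Finset.mem_insert, Sym2.congr_right, hT]
        constructor
        · rintro (rfl | ⟨i, hi⟩)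
          · exact ⟨j, by simp⟩
          · refine ⟨i, ?_⟩
            rw [if_neg, hi]
            rintro rfl
            simp [hblank] at hi
        · rintro ⟨i, hi⟩
          split_ifs at hi with h3
          · simp only [Option.some.injEq] at hi; exact Or.inl hi.symm
          · exact Or.inr ⟨i, hi⟩
    · obtain ⟨y, hy⟩ := Option.ne_none_iff_exists'.1 (hfull j)
      have hyT : s(v, y) ∈ T := (hT y).2 ⟨j, hy⟩
      have hTL : T.card = L := by
        rw [hnb, Finset.filter_true_of_mem (fun i _ => hfull i)]; simp
      have hminT : ∀ e ∈ T, w s(v, y) ≤ w e := by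
        intro e he
        obtain ⟨u, rfl⟩ := Sym2.mem_iff_exists.1 (hF e (hTF he))
        obtain ⟨i, hi⟩ := (hT u).1 he
        rw [← hW j y hy, ← hW i u hi]
        exact hmin i
      have hley : w s(v, y) ≤ w s(v, x) := by rw [← hW j y hy]; exact hle
      refine ⟨insert s(v, x) (T.erase s(v, y)), ⟨?_, ?_, ?_⟩, ?_, hinj', hW'⟩
      · exact Finset.insert_subset_insert _ ((Finset.erase_subset _ _).trans hTF)
      · have := Finset.card_le_card hTF
        rw [Finset.card_insert_of_notMem hx, Finset.card_insert_of_notMem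
          (fun h => hxT (Finset.mem_of_mem_erase h)), Finset.card_erase_of_mem hyT]
        omega
      · intro e he f hf hfT
        rw [Finset.mem_insert, not_or, Finset.mem_erase] at hfT
        have hfF : f ∈ F := (Finset.mem_insert.1 hf).resolve_left hfT.1
        have hfy : f ∉ T ∨ f = s(v, y) := by tauto
        rcases Finset.mem_insert.1 he with rfl | he
        · rcases hfy with hfy | rfl
          · exact (hheavy _ hyT f hfF hfy).trans hley
          · exact hley
        · have heT := Finset.mem_of_mem_erase he
          rcases hfy with hfy | rfl
          · exact hheavy e heT f hfF hfy
          · exact hminT e heT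
      · intro u
        beta_reduce
        rw [Finset.mem_insert, Sym2.congr_right, Finset.mem_erase, hT, Ne, Sym2.congr_right]
        constructor
        · rintro (rfl | ⟨hne, i, hi⟩)
          · exact ⟨j, by simp⟩
          · refine ⟨i, ?_⟩
            rw [if_neg, hi]
            rintro rfl
            rw [hy] at hi
            exact hne (Option.some.inj hi).symm
        · rintro ⟨i, hi⟩
          split_ifs at hi with h3
          · simp only [Option.some.injEq] at hi; exact Or.inl hi.symm
          · refine Or.inr ⟨?_, i, hi⟩
            rintro rfl
            exact h3 (hinj _ _ _ hy hi)

end Slots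

/-! ### Estimating the covered weight from the stored edges -/

section Estimate

variable {V : Type*} {L : ℕ}

/-- The edge held by the slot `q`. -/
def slotEdge (N : V → Fin L → Option V) (q : V × Fin L) : Sym2 V :=
  s(q.1, (N q.1 q.2).getD q.1)

/-- The slots of vertices in `S` that hold an edge with both endpoints in `S`. -/
def innerSlots [Fintype V] (N : V → Fin L → Option V) (S : Finset V) : Finset (V × Fin L) :=
  Finset.univ.filter fun q => q.1 ∈ S ∧ ∃ u ∈ S, N q.1 q.2 = some u

/-- An edge may be stored at both of its endpoints; picking one slot per edge prevents its weight
from being subtracted twice. -/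
theorem exists_representatives {α β : Type*} (f : α → β) (s : Finset α) :
    ∃ t ⊆ s, Set.InjOn f t ∧ ∀ a ∈ s, ∃ b ∈ t, f b = f a := by
  obtain ⟨t, ht, him, hinj⟩ := Finset.exists_subset_injOn_image_eq_of_surjOn
    (f := f) (s := (s : Set α)) (s.image f) (by intro y hy; simpa using hy)
  exact ⟨t, by exact_mod_cast ht, him, fun a ha =>
    Finset.mem_image.1 (hinj ▸ Finset.mem_image_of_mem f ha)⟩

/-- Slots that hold every stored edge with both endpoints in `S` exactly once. -/
def chosenSlots [Fintype V] (N : V → Fin L → Option V) (S : Finset V) : Finset (V × Fin L) :=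
  (exists_representatives (slotEdge N) (innerSlots N S)).choose

/-- The sum of the weighted degrees in `S` minus the weight of the stored edges inside `S`. -/
def estimate [Fintype V] (N : V → Fin L → Option V) (D : V → ℝ) (W : V → Fin L → ℝ)
    (S : Finset V) : ℝ :=
  ∑ v ∈ S, D v - ∑ q ∈ chosenSlots N S, W q.1 q.2

/-- Both endpoints of `e` are in `S`. -/
def Inside (S : Finset V) (e : Sym2 V) : Prop := ∀ v ∈ e, v ∈ S

/-- Some endpoint of `e` is in `S`. -/
def Touches (S : Finset V) (e : Sym2 V) : Prop := ∃ v ∈ S, v ∈ e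

/-- No endpoint of `e` stores `e`. -/
def Unstored (T : V → Finset (Sym2 V)) (e : Sym2 V) : Prop := ∀ v ∈ e, e ∉ T v

/-- The edges of `F` with both endpoints in `S`. -/
def innerEdges (F : Finset (Sym2 V)) (S : Finset V) : Finset (Sym2 V) :=
  F.filter (Inside S)

theorem chosenSlots_spec [Fintype V] (N : V → Fin L → Option V) (S : Finset V) :
    chosenSlots N S ⊆ innerSlots N S ∧ Set.InjOn (slotEdge N) (chosenSlots N S) ∧
      (chosenSlots N S).image (slotEdge N) = (innerSlots N S).image (slotEdge N) := by
  obtain ⟨h1, h2, h3⟩ :=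
    (exists_representatives (slotEdge N) (innerSlots N S)).choose_spec
  refine ⟨h1, h2, Finset.ext fun y => ?_⟩
  rw [Finset.mem_image, Finset.mem_image]
  constructor
  · rintro ⟨q, hq, rfl⟩
    exact ⟨q, h1 hq, rfl⟩
  · rintro ⟨q, hq, rfl⟩
    exact h3 q hq

/-- This matches the zero in both estimate variables when the search starts at the empty set. -/
theorem estimate_empty [Fintype V] (N : V → Fin L → Option V) (D : V → ℝ) (W : V → Fin L → ℝ) :
    estimate N D W ∅ = 0 := by
  have h : chosenSlots N ∅ = ∅ := by
    have := (chosenSlots_spec N ∅).1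
    simpa [innerSlots] using this
  simp [estimate, h]

/-- Handshake count by exchanging the sums: an edge contributes once per endpoint in `S`. A loop
would contribute once on the left but twice on the right. -/
theorem sum_degree_eq {F : Finset (Sym2 V)} (hF : ∀ e ∈ F, ¬ e.IsDiag) (w : Sym2 V → ℝ)
    (S : Finset V) :
    ∑ v ∈ S, ∑ e ∈ F.filter (fun e => v ∈ e), w e =
      ∑ e ∈ F.filter (Touches S), w e + ∑ e ∈ innerEdges F S, w e := by
  simp only [innerEdges, Finset.sum_filter]
  rw [Finset.sum_comm, ← Finset.sum_add_distrib]
  refine Finset.sum_congr rfl fun e he => ?_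
  have hd := hF e he
  induction e using Sym2.ind with
  | _ x y =>
    have hxy : x ≠ y := by simpa using hd
    have hsplit : ∀ v, (if v ∈ s(x, y) then w s(x, y) else 0) =
        (if v = x then w s(x, y) else 0) + (if v = y then w s(x, y) else 0) := by
      intro v
      by_cases h1 : v = x
      · have : v ≠ y := fun h => hxy (h1.symm.trans h)
        simp [h1, hxy]
      · by_cases h2 : v = y <;> simp [h1, h2, hxy.symm]
    rw [Finset.sum_congr rfl fun v _ => hsplit v, Finset.sum_add_distrib, Finset.sum_ite_eq',
      Finset.sum_ite_eq']
    by_cases h1 : x ∈ S <;> by_cases h2 : y ∈ S <;>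
      simp [Inside, Touches, h1, h2, and_or_left, exists_or]

/-- Together with `sum_degree_eq`, this bounds the degree sum by twice the covered weight. -/
theorem sum_innerEdges_le {F : Finset (Sym2 V)} {w : Sym2 V → ℝ} (hw : ∀ e ∈ F, 0 ≤ w e)
    (S : Finset V) :
    ∑ e ∈ innerEdges F S, w e ≤ ∑ e ∈ F.filter (Touches S), w e := by
  refine Finset.sum_le_sum_of_subset_of_nonneg ?_ fun e he _ => hw e (Finset.mem_filter.1 he).1
  intro e he
  obtain ⟨heF, he⟩ := Finset.mem_filter.1 he
  refine Finset.mem_filter.2 ⟨heF, ?_⟩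
  induction e using Sym2.ind with
  | _ x y => exact ⟨x, he x (by simp), by simp⟩

/-- An edge at `v` that is not among the `L` heaviest ones has at most a fraction `1 / L` of the
weighted degree of `v`. -/
theorem mul_le_degree_of_notMem {α : Type*} {w : α → ℝ} {F T : Finset α}
    (h : IsHeaviest w L F T) (hw : ∀ e ∈ F, 0 ≤ w e) {f : α} (hf : f ∈ F) (hfT : f ∉ T) :
    L * w f ≤ ∑ e ∈ F, w e := by
  obtain ⟨hTF, hcard, hheavy⟩ := h
  -- An omitted edge makes `T` a proper subset of `F`, so all `L` places are taken.
  have hTL : T.card = L := by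
    have : T.card < F.card :=
      Finset.card_lt_card ⟨hTF, fun h => hfT (h hf)⟩
    omega
  calc (L : ℝ) * w f = ∑ _e ∈ T, w f := by simp [hTL]
    _ ≤ ∑ e ∈ T, w e := Finset.sum_le_sum fun e he => hheavy e he f hf hfT
    _ ≤ ∑ e ∈ F, w e := Finset.sum_le_sum_of_subset_of_nonneg hTF fun e he _ => hw e he

/-- An inner edge at `v` is determined by its other endpoint, which lies in `S`. -/
theorem card_innerEdges_at_le (F : Finset (Sym2 V)) (S : Finset V) (v : V) :
    ((innerEdges F S).filter fun e => v ∈ e).card ≤ S.card := by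
  calc _ ≤ (S.image fun u => s(v, u)).card := by
        refine Finset.card_le_card fun e he => ?_
        obtain ⟨he, hv⟩ := Finset.mem_filter.1 he
        obtain ⟨u, rfl⟩ := Sym2.mem_iff_exists.1 hv
        exact Finset.mem_image.2 ⟨u, (Finset.mem_filter.1 he).2 u (by simp), rfl⟩
    _ ≤ S.card := Finset.card_image_le

/-- The estimate exceeds the covered weight by the weight of the inner edges that are not stored. -/
theorem estimate_eq [Fintype V] {w : Sym2 V → ℝ} {F : Finset (Sym2 V)} {N : V → Fin L → Option V}
    {W : V → Fin L → ℝ} (hF : ∀ e ∈ F, ¬ e.IsDiag)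
    (T : V → Finset (Sym2 V)) (hTF : ∀ v, T v ⊆ F)
    (hT : ∀ v u, s(v, u) ∈ T v ↔ ∃ i, N v i = some u)
    (hW : ∀ v i u, N v i = some u → W v i = w s(v, u)) (S : Finset V) :
    estimate N (fun v => ∑ e ∈ F.filter (fun e => v ∈ e), w e) W S =
      ∑ e ∈ F.filter (Touches S), w e +
        ∑ e ∈ (innerEdges F S).filter (Unstored T), w e := by
  obtain ⟨hsub, hinj, himg⟩ := chosenSlots_spec N S
  have hknown : ∑ q ∈ chosenSlots N S, W q.1 q.2 =
      ∑ e ∈ (innerEdges F S).filter (fun e => ¬ Unstored T e), w e := by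
    have himg' : (innerSlots N S).image (slotEdge N) =
        (innerEdges F S).filter (fun e => ¬ Unstored T e) := by
      ext e
      simp only [Finset.mem_image, innerSlots, innerEdges, Finset.mem_filter, Finset.mem_univ,
        true_and, slotEdge, Inside, Unstored, not_forall, not_not]
      constructor
      · rintro ⟨⟨v, i⟩, ⟨hv, u, hu, hN⟩, rfl⟩
        have hmem := (hT v u).2 ⟨i, hN⟩
        simp only at hN hv
        simp only [hN, Option.getD_some]
        refine ⟨⟨hTF v hmem, ?_⟩, v, by simp, hmem⟩
        intro z hz
        rcases Sym2.mem_iff.1 hz with rfl | rfl <;> assumption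
      · rintro ⟨⟨heF, hS⟩, v, hv, hmem⟩
        obtain ⟨u, rfl⟩ := Sym2.mem_iff_exists.1 hv
        obtain ⟨i, hi⟩ := (hT v u).1 hmem
        exact ⟨(v, i), ⟨hS v (by simp), u, hS u (by simp), hi⟩, by simp [hi]⟩
    rw [← himg', ← himg, Finset.sum_image hinj]
    refine Finset.sum_congr rfl fun q hq => ?_
    obtain ⟨-, u, -, hN⟩ := (Finset.mem_filter.1 (hsub hq)).2
    rw [hW _ _ _ hN, slotEdge, hN, Option.getD_some]
  rw [estimate, hknown, sum_degree_eq hF,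
    ← Finset.sum_filter_add_sum_filter_not (innerEdges F S) (Unstored T)]
  ring

/-- The weight of the inner edges that are not stored. -/
theorem sum_unstored_le {w : Sym2 V → ℝ} {F : Finset (Sym2 V)} {T : V → Finset (Sym2 V)}
    {k : ℕ} {ε : ℝ} (hk : 1 ≤ k) (hε : 0 < ε) (hL : 2 * (k : ℝ) / ε ≤ L)
    (hw : ∀ e ∈ F, 0 ≤ w e) (hT : ∀ v, IsHeaviest w L (F.filter fun e => v ∈ e) (T v))
    (S : Finset V) (hS : S.card ≤ k) :
    ∑ e ∈ (innerEdges F S).filter (Unstored T), w e ≤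
      ε / 2 * ∑ v ∈ S, ∑ e ∈ F.filter (fun e => v ∈ e), w e := by
  set U := (innerEdges F S).filter (Unstored T) with hU
  have hUF : ∀ e ∈ U, e ∈ F := fun e he => (Finset.mem_filter.1 (Finset.mem_filter.1 he).1).1
  -- Each unstored inner edge is charged to its endpoints, all of which lie in `S`.
  have h1 : ∑ e ∈ U, w e ≤ ∑ v ∈ S, ∑ e ∈ U.filter (fun e => v ∈ e), w e := by
    simp only [Finset.sum_filter]
    rw [Finset.sum_comm]
    refine Finset.sum_le_sum fun e he => ?_
    have hin := (Finset.mem_filter.1 (Finset.mem_filter.1 he).1).2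
    obtain ⟨x, hx⟩ : ∃ x, x ∈ e := by
      induction e using Sym2.ind with
      | _ x y => exact ⟨x, by simp⟩
    have := Finset.single_le_sum (f := fun v => if v ∈ e then w e else 0)
      (fun v _ => by split_ifs; exacts [hw e (hUF e he), le_rfl]) (hin x hx)
    simpa [hx] using this
  refine h1.trans ?_
  rw [Finset.mul_sum]
  refine Finset.sum_le_sum fun v _ => ?_
  set D := ∑ e ∈ F.filter (fun e => v ∈ e), w e with hD
  have hD0 : 0 ≤ D := Finset.sum_nonneg fun e he => hw e (Finset.mem_filter.1 he).1
  have hk0 : (0 : ℝ) < k := by exact_mod_cast hk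
  have hsmall : ∀ e ∈ U.filter (fun e => v ∈ e), w e ≤ ε / (2 * k) * D := by
    intro e he
    obtain ⟨heU, hv⟩ := Finset.mem_filter.1 he
    have h2 := mul_le_degree_of_notMem (hT v) (fun e he => hw e (Finset.mem_filter.1 he).1)
      (Finset.mem_filter.2 ⟨hUF e heU, hv⟩) ((Finset.mem_filter.1 heU).2 v hv)
    have h3 : 2 * (k : ℝ) / ε * w e ≤ D :=
      (mul_le_mul_of_nonneg_right hL (hw e (hUF e heU))).trans h2
    calc w e = ε / (2 * k) * (2 * (k : ℝ) / ε * w e) := by field_simp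
      _ ≤ ε / (2 * k) * D := by gcongr
  have hcard : (U.filter (fun e => v ∈ e)).card ≤ k :=
    (Finset.card_le_card (Finset.filter_subset_filter _ (Finset.filter_subset _ _))).trans
      ((card_innerEdges_at_le F S v).trans hS)
  calc ∑ e ∈ U.filter (fun e => v ∈ e), w e ≤ (U.filter (fun e => v ∈ e)).card • (ε / (2 * k) * D) :=
        Finset.sum_le_card_nsmul _ _ _ hsmall
    _ ≤ k * (ε / (2 * k) * D) := by
        rw [nsmul_eq_mul]; gcongr
    _ = ε / 2 * D := by field_simp

end Estimate

/-! ### The algorithm -/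

section Algorithm

/-- The vertex variables: the slots, and the characteristic functions of two sets of vertices. -/
abbrev VtxVar (V : Type*) (L : ℕ) := (V × Fin L) ⊕ (V ⊕ V)

/-- The weight variables: the slots, the weighted degrees, and two estimates. -/
abbrev WtVar (V : Type*) (L : ℕ) := (V × Fin L) ⊕ (V ⊕ Bool)

variable {V : Type*} {a b L : ℕ}

/-- The set of vertices whose variable is not blank. -/
def decode [Fintype V] (x : V → Option V) : Finset V := Finset.univ.filter fun v => x v ≠ none

/-- The vertex variables that represent a set. -/
def code (S : Finset V) (v : V) : Option V := if v ∈ S then some v else none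

theorem decode_code [Fintype V] (S : Finset V) : decode (code S) = S := by
  ext v; simp [decode, code]

/-- Starting with the empty set lets the untouched search variables, blank and zero, serve as the
initial state of the search. -/
theorem exists_enumeration (V : Type*) [Fintype V] :
    ∃ e : Finset V ≃ Fin (Fintype.card (Finset V)), (e ∅ : ℕ) = 0 := by
  have hpos : 0 < Fintype.card (Finset V) := Fintype.card_pos
  let e := Fintype.equivFin (Finset V)
  exact ⟨e.trans (Equiv.swap (e ∅) ⟨0, hpos⟩), by simp⟩

/-- An enumeration of the sets of vertices that starts with the empty set. -/
def enumeration (V : Type*) [Fintype V] : Finset V ≃ Fin (Fintype.card (Finset V)) :=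
  (exists_enumeration V).choose

theorem enumeration_empty (V : Type*) [Fintype V] : (enumeration V ∅ : ℕ) = 0 :=
  (exists_enumeration V).choose_spec

/-- The endpoint of `e` other than `v`. -/
def farEnd (v : V) (e : Sym2 V) : V := if h : v ∈ e then Sym2.Mem.other h else v

theorem mk_farEnd {v : V} {e : Sym2 V} (h : v ∈ e) : s(v, farEnd v e) = e := by
  rw [farEnd, dif_pos h, Sym2.other_spec]

variable (vi : VtxVar V L ≃ Fin a) (wi : WtVar V L ≃ Fin b)

/-- The slot of `v` that is overwritten when an edge at `v` arrives. -/
def slotVictim (x : Fin a → Option V) (le : Option (Fin b) → Option (Fin b) → Prop) (v : V) :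
    Option (Fin L) :=
  victim (fun i => x (vi (.inl (v, i))))
    (fun i j => le (some (wi (.inl (v, i)))) (some (wi (.inl (v, j)))))
    (fun i => le (some (wi (.inl (v, i)))) none)

/-- New values of the vertex variables when an edge arrives. -/
def updateVtx (x : Fin a → Option V) (e : Sym2 V)
    (le : Option (Fin b) → Option (Fin b) → Prop) : VtxVar V L → Option V
  | .inl (v, i) => if v ∈ e ∧ slotVictim vi wi x le v = some i then some (farEnd v e)
      else x (vi (.inl (v, i)))
  | .inr z => x (vi (.inr z))

/-- New values of the weight variables when an edge arrives. -/
def updateWt (x : Fin a → Option V) (e : Sym2 V)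
    (le : Option (Fin b) → Option (Fin b) → Prop) : WtVar V L → Source b
  | .inl (v, i) => if v ∈ e ∧ slotVictim vi wi x le v = some i then .arriving
      else .copy (wi (.inl (v, i)))
  | .inr (.inl v) => if v ∈ e then .add (wi (.inr (.inl v))) else .copy (wi (.inr (.inl v)))
  | .inr (.inr c) => .copy (wi (.inr (.inr c)))

theorem mem_incident {p : List (Sym2 V)} {v : V} {e : Sym2 V} :
    e ∈ incident p v ↔ e ∈ p ∧ v ∈ e := by
  simp [incident]

theorem incident_append_of_mem {p : List (Sym2 V)} {v : V} {e : Sym2 V} (h : v ∈ e) :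
    incident (p ++ [e]) v = insert e (incident p v) := by
  ext f
  simp only [mem_incident, List.mem_append, List.mem_singleton, Finset.mem_insert]
  constructor
  · rintro ⟨h1 | h1, h2⟩ <;> tauto
  · rintro (rfl | h1) <;> tauto

theorem incident_append_of_notMem {p : List (Sym2 V)} {v : V} {e : Sym2 V} (h : v ∉ e) :
    incident (p ++ [e]) v = incident p v := by
  ext f
  simp only [mem_incident, List.mem_append, List.mem_singleton]
  constructor
  · rintro ⟨h1 | rfl, h2⟩ <;> tauto
  · tauto

theorem stores_iff (lay : Layout V a b L) (m : Memory V a b) (w : Sym2 V → ℝ)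
    (p : List (Sym2 V)) :
    Stores lay m w p ↔ (∀ v, m.wt (lay.deg v) = ∑ e ∈ incident p v, w e) ∧
      ∀ v, SlotsHold w (incident p v) v (fun i => m.vtx (lay.nbr v i))
        (fun i => m.wt (lay.wt v i)) :=
  Iff.rfl

variable [Fintype V]

/-- The current set is independent, and its estimate is at least that of the best set so far. -/
def Improves (M : Matroid V) (x : Fin a → Option V) (le : Fin b → Fin b → Prop) : Prop :=
  M.Indep (decode fun v => x (vi (.inr (.inr v)))) ∧
    le (wi (.inr (.inr false))) (wi (.inr (.inr true)))

/-- The best set after examination of the current one. -/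
def newBest (M : Matroid V) (x : Fin a → Option V) (le : Fin b → Fin b → Prop) : Finset V :=
  if Improves vi wi M x le then decode fun v => x (vi (.inr (.inr v)))
  else decode fun v => x (vi (.inr (.inl v)))

/-- Vertex variables after a step that moves on to the set `S`. -/
def nextVtx (M : Matroid V) (x : Fin a → Option V) (le : Fin b → Fin b → Prop) (S : Finset V) :
    VtxVar V L → Option V
  | .inl q => x (vi (.inl q))
  | .inr (.inl v) => code (newBest vi wi M x le) v
  | .inr (.inr v) => code S v

/-- Weight variables after a step that moves on to the set `S`. -/
def nextWt (M : Matroid V) (x : Fin a → Option V) (le : Fin b → Fin b → Prop) (S : Finset V) :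
    WtVar V L → Finset (Fin b) × Finset (Fin b)
  | .inr (.inr false) =>
      if Improves vi wi M x le then ({wi (.inr (.inr true))}, ∅) else ({wi (.inr (.inr false))}, ∅)
  | .inr (.inr true) =>
      (S.image fun v => wi (.inr (.inl v)),
        (chosenSlots (fun v i => x (vi (.inl (v, i)))) S).image fun q => wi (.inl q))
  | q => ({wi q}, ∅)

/-- During the stream, the algorithm stores the weighted degrees and the heaviest edges at every
vertex. Afterwards it goes through all sets of vertices, and keeps an independent set with the
largest estimate. -/
def algorithm (M : Matroid V) : StreamAlg V a b where
  init := fun _ => none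
  update x e le :=
    (fun p => updateVtx vi wi x e le (vi.symm p), fun p => updateWt vi wi x e le (wi.symm p))
  post x le :=
    if h : (enumeration V (decode fun v => x (vi (.inr (.inr v)))) : ℕ) + 1 <
        Fintype.card (Finset V) then
      .inr (fun p => nextVtx vi wi M x le ((enumeration V).symm ⟨_, h⟩) (vi.symm p),
        fun p => nextWt vi wi M x le ((enumeration V).symm ⟨_, h⟩) (wi.symm p))
    else .inl (newBest vi wi M x le)

/-- Where the weighted degrees and the heaviest edges are stored. -/
def layout : Layout V a b L :=
  ⟨fun v => wi (.inr (.inl v)), fun v i => vi (.inl (v, i)), fun v i => wi (.inl (v, i))⟩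

/-- Induction on the stream, one edge appended at a time. The search variables are carried along
because the search relies on their initial values. -/
theorem stores_memAfter (hL : 0 < L) (M : Matroid V) (w : Sym2 V → ℝ) (p : List (Sym2 V))
    (hp : p.Nodup) :
    Stores (layout vi wi) ((algorithm vi wi M).memAfter w p) w p ∧
      (∀ z, ((algorithm vi wi M).memAfter w p).vtx (vi (.inr z)) = none) ∧
      ∀ c, ((algorithm vi wi M).memAfter w p).wt (wi (.inr (.inr c))) = 0 := by
  induction p using List.reverseRecOn with
  | nil =>
    rw [stores_iff]
    refine ⟨⟨fun v => ?_, fun v => ?_⟩, fun z => rfl, fun c => rfl⟩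
    · simp [incident, StreamAlg.memAfter, StreamAlg.start]
    · have : incident ([] : List (Sym2 V)) v = ∅ := by simp [incident]
      rw [this]
      exact slotsHold_empty w v _
  | append_singleton p e ih =>
    obtain ⟨hst, hv, hw⟩ := ih (hp.sublist (List.sublist_append_left _ _))
    -- A repeated edge would be counted twice in a degree and could occupy two slots.
    have hep : e ∉ p := by
      rw [List.nodup_append] at hp
      exact fun h => hp.2.2 e h e (by simp) rfl
    have hmem : (algorithm vi wi M).memAfter w (p ++ [e]) =
        (algorithm vi wi M).step ((algorithm vi wi M).memAfter w p) e (w e) := by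
      simp [StreamAlg.memAfter]
    rw [hmem]
    set m := (algorithm vi wi M).memAfter w p
    rw [stores_iff] at hst ⊢
    obtain ⟨hdeg, hslots⟩ := hst
    refine ⟨⟨fun v => ?_, fun v => ?_⟩, fun z => ?_, fun c => ?_⟩
    · have hd := hdeg v
      by_cases hve : v ∈ e
      · rw [incident_append_of_mem hve, Finset.sum_insert (by simp [mem_incident, hep]), ← hd]
        simp [StreamAlg.step, algorithm, layout, updateWt, hve, Source.value, add_comm]
      · rw [incident_append_of_notMem hve, ← hd]
        simp [StreamAlg.step, algorithm, layout, updateWt, hve, Source.value]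
    · have hs := hslots v
      by_cases hve : v ∈ e
      · have hx := mk_farEnd hve
        have := hs.insert_edge (x := farEnd v e) hL
          (fun f hf => (mem_incident.1 hf).2) (by rw [hx, mem_incident]; tauto)
        rw [hx] at this
        rw [incident_append_of_mem hve]
        convert this using 2 with i i
        · simp only [StreamAlg.step, algorithm, layout, updateVtx, hve, slotVictim,
            Equiv.symm_apply_apply, true_and, Option.elim]
          exact if_congr Iff.rfl rfl rfl
        · simp only [StreamAlg.step, algorithm, layout, updateWt, hve, slotVictim,
            Equiv.symm_apply_apply, true_and, Option.elim]
          rw [apply_ite (Source.value m.wt (w e))]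
          exact if_congr Iff.rfl rfl rfl
      · rw [incident_append_of_notMem hve]
        convert hs using 2 with i i
        · simp [StreamAlg.step, algorithm, layout, updateVtx, hve]
        · simp [StreamAlg.step, algorithm, layout, updateWt, hve, Source.value]
    · simpa [StreamAlg.step, algorithm, updateVtx] using hv z
    · simpa [StreamAlg.step, algorithm, updateWt, Source.value] using hw c

/-- The state of the search when the set `S` is about to be examined. -/
structure SearchState (M : Matroid V) (N : V → Fin L → Option V) (D : V → ℝ)
    (W : V → Fin L → ℝ) (m : Memory V a b) (B S : Finset V) : Prop where
  nbr : ∀ v i, m.vtx (vi (.inl (v, i))) = N v i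
  slot : ∀ v i, m.wt (wi (.inl (v, i))) = W v i
  deg : ∀ v, m.wt (wi (.inr (.inl v))) = D v
  best : decode (fun v => m.vtx (vi (.inr (.inl v)))) = B
  current : decode (fun v => m.vtx (vi (.inr (.inr v)))) = S
  indep : M.Indep (B : Set V)
  best_wt : m.wt (wi (.inr (.inr false))) = estimate N D W B
  current_wt : m.wt (wi (.inr (.inr true))) = estimate N D W S
  le_best : ∀ S', enumeration V S' < enumeration V S → M.Indep (S' : Set V) →
    estimate N D W S' ≤ estimate N D W B

variable {vi wi} {M : Matroid V} {N : V → Fin L → Option V} {D : V → ℝ} {W : V → Fin L → ℝ}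

theorem SearchState.improves_iff {m : Memory V a b} {B S : Finset V}
    (h : SearchState vi wi M N D W m B S) :
    Improves vi wi M m.vtx (fun i j => m.wt i ≤ m.wt j) ↔
      M.Indep (S : Set V) ∧ estimate N D W B ≤ estimate N D W S := by
  rw [Improves, h.current, h.best_wt, h.current_wt]

theorem SearchState.newBest_eq {m : Memory V a b} {B S : Finset V}
    (h : SearchState vi wi M N D W m B S) :
    newBest vi wi M m.vtx (fun i j => m.wt i ≤ m.wt j) =
      if M.Indep (S : Set V) ∧ estimate N D W B ≤ estimate N D W S then S else B := by
  rw [newBest, h.current, h.best]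
  exact if_congr h.improves_iff rfl rfl

/-- Examining `S` turns the strict bound in `le_best` into a weak one. If `S` is independent but
rejected, its estimate is below that of `B`. -/
theorem SearchState.newBest_spec {m : Memory V a b} {B S : Finset V}
    (h : SearchState vi wi M N D W m B S) :
    M.Indep (newBest vi wi M m.vtx (fun i j => m.wt i ≤ m.wt j) : Set V) ∧
      ∀ S', enumeration V S' ≤ enumeration V S → M.Indep (S' : Set V) →
        estimate N D W S' ≤
          estimate N D W (newBest vi wi M m.vtx (fun i j => m.wt i ≤ m.wt j)) := by
  rw [h.newBest_eq]
  split_ifs with hi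
  · refine ⟨hi.1, fun S' hle hS' => ?_⟩
    rcases hle.lt_or_eq with hlt | heq
    · exact (h.le_best S' hlt hS').trans hi.2
    · rw [(enumeration V).injective heq]
  · refine ⟨h.indep, fun S' hle hS' => ?_⟩
    rcases hle.lt_or_eq with hlt | heq
    · exact h.le_best S' hlt hS'
    · have := (enumeration V).injective heq
      subst this
      exact (not_le.1 fun hle => hi ⟨hS', hle⟩).le

theorem SearchState.exists_next {m : Memory V a b} {B S : Finset V}
    (h : SearchState vi wi M N D W m B S)
    (hlt : (enumeration V S : ℕ) + 1 < Fintype.card (Finset V)) :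
    ∃ m', (algorithm vi wi M).postStep m = .inr m' ∧
      SearchState vi wi M N D W m' (newBest vi wi M m.vtx (fun i j => m.wt i ≤ m.wt j))
        ((enumeration V).symm ⟨_, hlt⟩) := by
  obtain ⟨hind, hle⟩ := h.newBest_spec
  set S₁ := (enumeration V).symm ⟨_, hlt⟩ with hS₁
  have hN : (fun v i => m.vtx (vi (.inl (v, i)))) = N := by
    funext v i; exact h.nbr v i
  have hcur := h.current
  subst hcur
  refine ⟨⟨fun p => nextVtx vi wi M m.vtx (fun i j => m.wt i ≤ m.wt j) S₁ (vi.symm p),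
    fun p => ∑ j ∈ (nextWt vi wi M m.vtx (fun i j => m.wt i ≤ m.wt j) S₁ (wi.symm p)).1, m.wt j -
      ∑ j ∈ (nextWt vi wi M m.vtx (fun i j => m.wt i ≤ m.wt j) S₁ (wi.symm p)).2, m.wt j⟩, ?_, ?_⟩
  · simp only [StreamAlg.postStep, algorithm]
    rw [dif_pos hlt]
  · constructor
    · intro v i; simpa [nextVtx] using h.nbr v i
    · intro v i; simpa [nextWt] using h.slot v i
    · intro v; simpa [nextWt] using h.deg v
    · simp only [nextVtx, Equiv.symm_apply_apply]; exact decode_code _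
    · simp only [nextVtx, Equiv.symm_apply_apply]; exact decode_code _
    · exact hind
    · rw [h.newBest_eq]
      simp only [nextWt, Equiv.symm_apply_apply, h.improves_iff]
      split_ifs
      · simpa using h.current_wt
      · simpa using h.best_wt
    -- Which weights to add and subtract depends on vertex variables alone, so the estimate of the
    -- next set needs a single step.
    · simp only [nextWt, Equiv.symm_apply_apply, hN, estimate]
      rw [Finset.sum_image (by intro x _ y _ hxy; simpa using hxy),
        Finset.sum_image (by intro x _ y _ hxy; simpa using hxy)]
      congr 1
      · exact Finset.sum_congr rfl fun v _ => h.deg v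
      · exact Finset.sum_congr rfl fun q _ => h.slot q.1 q.2
    · intro S' hlt' hS'
      refine hle S' ?_ hS'
      rw [hS₁, Equiv.apply_symm_apply, Fin.lt_def] at hlt'
      -- The next index is one larger, so lying before it means lying at or before the set just
      -- examined.
      exact Fin.le_def.2 (Nat.lt_succ_iff.1 hlt')

/-- Induction on the number of sets still to be examined; the last set is examined in the very step
that stops. -/
theorem SearchState.exists_output {m : Memory V a b} {B S : Finset V}
    (h : SearchState vi wi M N D W m B S) :
    ∃ n S₀, (algorithm vi wi M).runPost n m = some S₀ ∧ M.Indep (S₀ : Set V) ∧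
      ∀ S' : Finset V, M.Indep (S' : Set V) → estimate N D W S' ≤ estimate N D W S₀ := by
  induction hd : Fintype.card (Finset V) - enumeration V S using Nat.strong_induction_on
    generalizing m B S with
  | _ d ih =>
    by_cases hlt : (enumeration V S : ℕ) + 1 < Fintype.card (Finset V)
    · obtain ⟨m', hstep, h'⟩ := h.exists_next hlt
      obtain ⟨n, S₀, hrun, hS₀⟩ := ih _ (by rw [Equiv.apply_symm_apply]; simp only; omega) h' rfl
      exact ⟨n + 1, S₀, by simp [StreamAlg.runPost, hstep, hrun], hS₀⟩
    · obtain ⟨hind, hle⟩ := h.newBest_spec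
      refine ⟨1, _, ?_, hind, fun S' hS' => hle S' ?_ hS'⟩
      · have hstep : (algorithm vi wi M).postStep m =
            .inl (newBest vi wi M m.vtx (fun i j => m.wt i ≤ m.wt j)) := by
          have hcur := h.current
          subst hcur
          simp only [StreamAlg.postStep, algorithm]
          rw [dif_neg hlt]
        simp [StreamAlg.runPost, hstep]
      · have := (enumeration V S').isLt
        exact Fin.le_def.2 (by omega)

end Algorithm

/-! ### Quality of the output -/

section Quality

variable {V : Type*} [Fintype V] {a b L : ℕ}

theorem coverWeight_eq {G : SimpleGraph V} {l : List (Sym2 V)} (hl : IsEdgeStream G l)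
    (w : Sym2 V → ℝ) (S : Finset V) :
    coverWeight G w S = ∑ e ∈ l.toFinset.filter (Touches S), w e := by
  refine Finset.sum_congr (Finset.ext fun e => ?_) fun _ _ => rfl
  simp [hl.2 e, Touches]

/-- The overshoot is the unstored inner weight. It is nonnegative, and at most `ε / 2` times cover
plus inner weight, hence at most `ε` times the cover. -/
theorem coverWeight_le_estimate_le {G : SimpleGraph V} {w : Sym2 V → ℝ}
    (hw : ∀ e ∈ G.edgeSet, 0 ≤ w e) {l : List (Sym2 V)} (hl : IsEdgeStream G l)
    {k : ℕ} {ε : ℝ} (hk : 1 ≤ k) (hε : 0 < ε) (hL : 2 * (k : ℝ) / ε ≤ L)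
    {lay : Layout V a b L} {m : Memory V a b} (hm : Stores lay m w l) {S : Finset V}
    (hS : S.card ≤ k) :
    coverWeight G w S ≤ estimate (fun v i => m.vtx (lay.nbr v i)) (fun v => m.wt (lay.deg v))
        (fun v i => m.wt (lay.wt v i)) S ∧
      estimate (fun v i => m.vtx (lay.nbr v i)) (fun v => m.wt (lay.deg v))
        (fun v i => m.wt (lay.wt v i)) S ≤ (1 + ε) * coverWeight G w S := by
  obtain ⟨hdeg, hslots⟩ := hm
  choose T hheavy hT hinj hW using hslots
  have hF : ∀ e ∈ l.toFinset, ¬ e.IsDiag := fun e he =>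
    G.not_isDiag_of_mem_edgeSet ((hl.2 e).1 (List.mem_toFinset.1 he))
  have hwF : ∀ e ∈ l.toFinset, 0 ≤ w e := fun e he => hw e ((hl.2 e).1 (List.mem_toFinset.1 he))
  have hinc : ∀ v, incident l v = l.toFinset.filter fun e => v ∈ e := fun v => by
    ext e; simp [mem_incident]
  have hD : (fun v => m.wt (lay.deg v)) =
      fun v => ∑ e ∈ l.toFinset.filter (fun e => v ∈ e), w e := by
    funext v; rw [hdeg, hinc]
  have hest := estimate_eq hF T
    (fun v => (hheavy v).1.trans (by rw [hinc]; exact Finset.filter_subset _ _)) hT hW S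
  have hun := sum_unstored_le hk hε hL hwF (fun v => hinc v ▸ hheavy v) S hS
  have hnn : 0 ≤ ∑ e ∈ (innerEdges l.toFinset S).filter (Unstored T), w e :=
    Finset.sum_nonneg fun e he =>
      hwF e (Finset.mem_filter.1 (Finset.mem_filter.1 he).1).1
  have hsum := sum_degree_eq hF w S
  have hin := sum_innerEdges_le hwF S
  rw [hD, hest, coverWeight_eq hl]
  refine ⟨by linarith, ?_⟩
  rw [hsum] at hun
  nlinarith

theorem exists_output (vi : VtxVar V L ≃ Fin a) (wi : WtVar V L ≃ Fin b) {M : Matroid V}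
    {G : SimpleGraph V} {w : Sym2 V → ℝ} (hw : ∀ e ∈ G.edgeSet, 0 ≤ w e) {l : List (Sym2 V)}
    (hl : IsEdgeStream G l) {k : ℕ} {ε : ℝ} (hk : 1 ≤ k) (hε : 0 < ε)
    (hL : 2 * (k : ℝ) / ε ≤ L) (hL0 : 0 < L) (hM : M.eRank = k) :
    ∃ S : Finset V, (algorithm vi wi M).Outputs w l S ∧ IsApproxSolution M G w (1 - ε) S := by
  obtain ⟨hst, hv, hz⟩ := stores_memAfter vi wi hL0 M w l hl.1
  have hinit : SearchState vi wi M _ _ _ ((algorithm vi wi M).memAfter w l) ∅ ∅ :=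
    { nbr := fun _ _ => rfl
      slot := fun _ _ => rfl
      deg := fun _ => rfl
      best := by simp [decode, hv]
      current := by simp [decode, hv]
      indep := by simp
      best_wt := by rw [hz, estimate_empty]
      current_wt := by rw [hz, estimate_empty]
      le_best := fun S' h => by
        rw [Fin.lt_def, enumeration_empty] at h
        exact absurd h (Nat.not_lt_zero _) }
  obtain ⟨n, S, hrun, hind, hbest⟩ := hinit.exists_output
  have hcard : ∀ {O : Finset V}, M.Indep (O : Set V) → O.card ≤ k := fun {O} hO => by
    have := hO.encard_le_eRank
    rw [hM, Set.encard_coe_eq_coe_finsetCard] at this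
    exact_mod_cast this
  refine ⟨S, ⟨n, hrun⟩, hind, fun O hO => ?_⟩
  have h1 := (coverWeight_le_estimate_le hw hl hk hε hL hst (hcard hO)).1
  have h2 := (coverWeight_le_estimate_le hw hl hk hε hL hst (hcard hind)).2
  have h3 : coverWeight G w O ≤ (1 + ε) * coverWeight G w S := (h1.trans (hbest O hO)).trans h2
  have h0 : 0 ≤ coverWeight G w O := Finset.sum_nonneg fun e he =>
    hw e (Finset.mem_filter.1 he).2.1
  -- After multiplication by `1 + ε`, the loss against `h3` is `ε ^ 2` times the weight covered by
  -- `O`.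
  have h4 : (1 + ε) * ((1 - ε) * coverWeight G w O) ≤ (1 + ε) * coverWeight G w S := by
    nlinarith [mul_nonneg (sq_nonneg ε) h0]
  exact le_of_mul_le_mul_left h4 (by linarith)

/-- The total is `2nL + 3n + 2`. As `k / ε ≥ 1`, rounding up costs at most `k / ε`, so `L ≤ 3k / ε`,
and `6 + 3 + 2 = 11`. -/
theorem card_variables_le (V : Type*) [Fintype V] [Nonempty V] {k : ℕ} {ε : ℝ} (hk : 1 ≤ k)
    (hε : 0 < ε) (hε1 : ε ≤ 1) :
    (Fintype.card (VtxVar V ⌈2 * (k : ℝ) / ε⌉₊) : ℝ) +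
      (Fintype.card (WtVar V ⌈2 * (k : ℝ) / ε⌉₊) : ℝ) ≤
        11 * ((Fintype.card V : ℝ) * (k : ℝ) / ε) := by
  have hk1 : (1 : ℝ) ≤ k := by exact_mod_cast hk
  have hn : (1 : ℝ) ≤ Fintype.card V := by exact_mod_cast Fintype.card_pos (α := V)
  have hq : 1 ≤ (k : ℝ) / ε := by rw [le_div_iff₀ hε]; linarith
  have hL : ((⌈2 * (k : ℝ) / ε⌉₊ : ℕ) : ℝ) ≤ 3 * (k / ε) := by
    have := (Nat.ceil_lt_add_one (a := 2 * (k : ℝ) / ε) (by positivity)).le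
    have h2 : 2 * (k : ℝ) / ε = 2 * (k / ε) := by ring
    linarith
  simp only [Fintype.card_sum, Fintype.card_prod, Fintype.card_fin, Fintype.card_bool]
  push_cast
  have h1 := mul_le_mul_of_nonneg_left hL (zero_le_one.trans hn)
  have h2 := mul_le_mul_of_nonneg_left hq (zero_le_one.trans hn)
  rw [mul_div_assoc (Fintype.card V : ℝ)]
  linarith

end Quality

end MatroidVC

end

/-- The number of variables of the algorithm is bounded before the matroid, the graph and the stream
are chosen. The algorithm has free access to the matroid `M`, and learns about the graph only
through the stream. -/
theorem mainTheorem6 :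
    ∃ C : ℝ, 0 < C ∧
      ∀ (V : Type*) [Fintype V] [Nonempty V] (k : ℕ) (ε : ℝ), 1 ≤ k → 0 < ε → ε ≤ 1 →
        ∃ (a b : ℕ) (A : Matroid V → MatroidVC.StreamAlg V a b)
          (lay : MatroidVC.Layout V a b ⌈2 * (k : ℝ) / ε⌉₊),
          ((a : ℝ) + (b : ℝ) ≤ C * ((Fintype.card V : ℝ) * (k : ℝ) / ε)) ∧
          ∀ M : Matroid V, M.eRank = (k : ℕ∞) →
            (MatroidVC.IsUniform M ∨ MatroidVC.IsPartition M ∨ MatroidVC.IsLaminar M ∨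
              MatroidVC.IsTransversal M) →
            ∀ (G : SimpleGraph V) (w : Sym2 V → ℝ), (∀ e ∈ G.edgeSet, 0 ≤ w e) →
              ∀ l : List (Sym2 V), MatroidVC.IsEdgeStream G l →
                (∃ S : Finset V, (A M).Outputs w l S ∧
                  MatroidVC.IsApproxSolution M G w (1 - ε) S) ∧
                ∀ p : List (Sym2 V), p <+: l →
                  MatroidVC.Stores lay ((A M).memAfter w p) w p := by
  refine ⟨11, by norm_num, fun V _ _ k ε hk hε hε1 => ?_⟩
  have hL : 2 * (k : ℝ) / ε ≤ (⌈2 * (k : ℝ) / ε⌉₊ : ℕ) := Nat.le_ceil _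
  have hL0 : 0 < ⌈2 * (k : ℝ) / ε⌉₊ := by
    have : (0 : ℝ) < k := by exact_mod_cast hk
    exact Nat.ceil_pos.2 (by positivity)
  have vi := Fintype.equivFin (MatroidVC.VtxVar V ⌈2 * (k : ℝ) / ε⌉₊)
  have wi := Fintype.equivFin (MatroidVC.WtVar V ⌈2 * (k : ℝ) / ε⌉₊)
  refine ⟨_, _, MatroidVC.algorithm vi wi, MatroidVC.layout vi wi,
    MatroidVC.card_variables_le V hk hε hε1, fun M hM _ G w hw l hl => ⟨?_, fun p hp => ?_⟩⟩
  · exact MatroidVC.exists_output vi wi hw hl hk hε hL hL0 hM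
  · exact (MatroidVC.stores_memAfter vi wi hL0 M w p (hl.1.sublist hp.sublist)).1
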